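/- Fix $p\in(0,\tfrac12)$; logarithms are to base $2$, and $I(p)=1+p\log p+(1-p)\log(1-p)$. An algorithm for noisy sorting of $n$ elements $a_1,\dots,a_n$ of a linearly ordered set may adaptively and repeatedly query pairs $(i,j)\in\{1,\dots,n\}^2$; each query (noisy comparison) returns the truth value of $a_i<a_j$, flipped with probability $p$, independently for every query. It may use private randomness, independent of the noise and of the input, and when it halts it outputs a permutation $b_1,\dots,b_n$ of $a_1,\dots,a_n$. It errs if it does not halt or if $b_1\le b_2\le\dots\le b_n$ fails. Then for every sequence $\delta_n\to 0$ there is a sequence $\varepsilon_n\to 0$ (depending only on $p$ and $(\delta_n)$) such that for every $n$, every deterministic or randomized algorithm for noisy sorting of $n$ elements which errs with probability at most $\delta_n$ on a uniformly random permutation of $n$ distinct elements makes, in expectation on a uniformly random permutation of $n$ distinct elements, at least $$(1-\varepsilon_n)\left(\frac1{I(p)}+\frac1{(1-2p)\log\frac{1-p}p}\right)n\log n$$ noisy comparisons. -/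

import Mathlib

open MeasureTheory ProbabilityTheory Filter Topology
open scoped ENNReal

namespace NoisySorting

noncomputable section

/-- The binary entropy function `h(p) = -p log₂ p - (1-p) log₂ (1-p)`. -/
def binaryEntropy (p : ℝ) : ℝ :=
  -(p * Real.logb 2 p) - (1 - p) * Real.logb 2 (1 - p)

/-- `I(p) = 1 - h(p)`, the capacity of the binary symmetric channel with crossover
probability `p`. -/
def capacity (p : ℝ) : ℝ := 1 - binaryEntropy p

/-- What an algorithm on `n` elements does next: query `NoisyComparison(a_i, a_j)`, or halt and
output the rearrangement `b_k = a_(π k)` of the input. -/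
inductive Move (n : ℕ) : Type
  | compare (i j : Fin n) : Move n
  | output (π : Equiv.Perm (Fin n)) : Move n

/-- There are finitely many moves; all sets of moves are measurable. -/
instance (n : ℕ) : MeasurableSpace (Move n) := ⊤

/-- A deterministic algorithm: an adaptive choice of the next move, given the list of all answers
received so far (the most recent answer first). The queries that were asked are determined by the
earlier answers. Nothing forces the algorithm to halt, and queries may be repeated. -/
abbrev Strategy (n : ℕ) : Type := List Bool → Move n

/-- A (randomized) algorithm: a random seed `ω`, drawn once from an arbitrary probability space,
selects a deterministic algorithm. Deterministic algorithms are those with a one-point `Ω`. -/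
structure Algorithm (n : ℕ) (Ω : Type*) [MeasurableSpace Ω] where
  /-- The distribution of the seed. -/
  seedLaw : Measure Ω
  /-- The seed has a probability distribution. -/
  isProbabilityMeasure_seedLaw : IsProbabilityMeasure seedLaw
  /-- The deterministic algorithm selected by the seed. -/
  strategy : Ω → Strategy n
  /-- The next move is a random variable. -/
  measurable_strategy : ∀ answers : List Bool, Measurable fun ω => strategy ω answers

section Run

variable {n : ℕ} {α : Type*} [LinearOrder α]

/-- The answers received within the first `t` steps (most recent first), on input `a` and noise
`z`: the answer to a query `(i, j)` made in step `t` is the truth value of `a_i < a_j`, flipped iff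
`z t = true`. Once the algorithm has halted the list does not change any more. -/
def answers (s : Strategy n) (a : Fin n → α) (z : ℕ → Bool) : ℕ → List Bool
  | 0 => []
  | t + 1 =>
    match s (answers s a z t) with
    | .compare i j => xor (decide (a i < a j)) (z t) :: answers s a z t
    | .output _ => answers s a z t

open Classical in
/-- The total number of noisy comparisons made (`∞` if the algorithm does not halt). -/
def queryCount (s : Strategy n) (a : Fin n → α) (z : ℕ → Bool) : ℝ≥0∞ :=
  ∑' t : ℕ, if ∃ i j, s (answers s a z t) = .compare i j then 1 else 0

/-- The run is successful: the algorithm halts, and its output `b_k = a_(π k)` satisfies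
`b_1 ≤ b_2 ≤ ... ≤ b_n`. -/
def Succeeds (s : Strategy n) (a : Fin n → α) (z : ℕ → Bool) : Prop :=
  ∃ (t : ℕ) (π : Equiv.Perm (Fin n)), s (answers s a z t) = .output π ∧ Monotone fun k => a (π k)

end Run

/-- The law of the noise: independent bits, each equal to `true` with probability `p`. -/
def noise (p : unitInterval) : Measure (ℕ → Bool) :=
  Measure.infinitePi fun _ : ℕ => bernoulliMeasure true false p

namespace Algorithm

variable {n : ℕ} {Ω : Type*} [MeasurableSpace Ω] {α : Type*} [LinearOrder α]

/-- The error probability on a fixed input, over the seed and the independent noise. -/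
def errorProb (A : Algorithm n Ω) (p : unitInterval) (a : Fin n → α) : ℝ≥0∞ :=
  (A.seedLaw.prod (noise p)) {x | ¬ Succeeds (A.strategy x.1) a x.2}

/-- The expected number of noisy comparisons on a fixed input, over the seed and the independent
noise. -/
def expectedQueries (A : Algorithm n Ω) (p : unitInterval) (a : Fin n → α) : ℝ≥0∞ :=
  ∫⁻ x, queryCount (A.strategy x.1) a x.2 ∂(A.seedLaw.prod (noise p))

/-- The error probability on a uniformly random permutation `a_1, ..., a_n` of `n` ordered
elements. -/
def uniformErrorProb (A : Algorithm n Ω) (p : unitInterval) : ℝ≥0∞ :=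
  (∑ σ : Equiv.Perm (Fin n), A.errorProb p σ) / Nat.factorial n

/-- The expected number of noisy comparisons on a uniformly random permutation of `n` ordered
elements. -/
def uniformExpectedQueries (A : Algorithm n Ω) (p : unitInterval) : ℝ≥0∞ :=
  (∑ σ : Equiv.Perm (Fin n), A.expectedQueries p σ) / Nat.factorial n

end Algorithm

end

end NoisySorting

/-! Comparisons are split according to whether the two ranks are neighbouring. A change of measure
bounds the expected number of each kind from below, and the bounds add because the kinds are
disjoint. Logarithms are natural until the final theorem.

The tool (`value_le_add_value_klDiv`, `mul_value_hit_le`) says that an event likely under the true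
answers `q` but unlikely under reference answers `r` forces a large accumulated relative entropy of
`q` with respect to `r`, and this entropy is a sum of costs of single queries.

Neighbouring ranks: exchanging ranks `k` and `k + 1` in `σ` affects only the answers to comparisons
of these two elements, each worth `D = (1 - 2p) log ((1 - p) / p)`. The `N` outputs correct for the
`N` swapped inputs exclude each other, so averaged over `σ` and `k` a run on the swapped input
outputs the answer for `σ` with probability at most `1 / N`. Hence about `log N / D` comparisons are
needed for each of the `N` neighbouring pairs (`log_mul_sum_hit_le_adj`).

Other ranks: a genie reveals, at the first query of a pair, whether its ranks are neighbouring and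
in which order. Under the reference measure the type is 0 with probability `1 - ρ`, and a comparison
of type 0 is a fair coin, so correct guesses for all `n!` inputs have total weight at most 1.
Comparisons of neighbours then cost entropy only when new, at most `2 n log (2 / ρ)` in all, and
every other comparison costs at most `log 2 - h(p) - log (1 - ρ)`. Hence these others must supply
almost all of `log n!` (`log_factorial_mul_sum_hit_le_nonadj`).

Runs are truncated at `m` steps, `m` tends to infinity, the seed is averaged out, and `ρ = 1 / (2 +
log n)` makes every loss `o(n log n)`. -/

namespace NoisySorting

/-! ### Truncated decision trees and change of measure -/

section Value

variable {n : ℕ}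

/-- The expected total cost of the first `m` steps of the strategy `s` started from the history
`h`, when the answer `b` arrives with weight `q h b`, a query made at history `h` costs `d h` and
ending with history `h` costs `F h`. -/
noncomputable def value (s : Strategy n) (q : List Bool → Bool → ℝ) (d F : List Bool → ℝ) :
    ℕ → List Bool → ℝ
  | 0, h => F h
  | m + 1, h =>
    match s h with
    | .output _ => F h
    | .compare _ _ => d h + (q h true * value s q d F m (true :: h) +
        q h false * value s q d F m (false :: h))

variable {s : Strategy n} {q : List Bool → Bool → ℝ} {d F : List Bool → ℝ}

theorem value_succ_output {m : ℕ} {h : List Bool} {π : Equiv.Perm (Fin n)}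
    (hs : s h = .output π) : value s q d F (m + 1) h = F h := by
  simp [value, hs]

theorem value_succ_compare {m : ℕ} {h : List Bool} {i j : Fin n}
    (hs : s h = .compare i j) : value s q d F (m + 1) h =
      d h + (q h true * value s q d F m (true :: h) +
        q h false * value s q d F m (false :: h)) := by
  simp [value, hs]

theorem value_linear {d' F' : List Bool → ℝ} (a b : ℝ) (m : ℕ) (h : List Bool) :
    value s q (fun h => a * d h + b * d' h) (fun h => a * F h + b * F' h) m h =
      a * value s q d F m h + b * value s q d' F' m h := by
  induction m generalizing h with
  | zero => rfl
  | succ m ih =>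
    rcases hs : s h with ⟨i, j⟩ | π
    · simp only [value_succ_compare hs, ih]; ring
    · simp only [value_succ_output hs]

theorem value_sum {ι : Type*} (t : Finset ι) (d F : ι → List Bool → ℝ) (m : ℕ) (h : List Bool) :
    value s q (fun h => ∑ k ∈ t, d k h) (fun h => ∑ k ∈ t, F k h) m h =
      ∑ k ∈ t, value s q (d k) (F k) m h := by
  induction m generalizing h with
  | zero => rfl
  | succ m ih =>
    rcases hs : s h with ⟨i, j⟩ | π
    · simp only [value_succ_compare hs, ih, Finset.mul_sum, Finset.sum_add_distrib]
    · simp only [value_succ_output hs]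

theorem value_mono (hq : ∀ h b, 0 ≤ q h b) {d' F' : List Bool → ℝ}
    (hd : ∀ h i j, s h = .compare i j → d h ≤ d' h) (hF : ∀ h, F h ≤ F' h) (m : ℕ)
    (h : List Bool) : value s q d F m h ≤ value s q d' F' m h := by
  induction m generalizing h with
  | zero => exact hF h
  | succ m ih =>
    rcases hs : s h with ⟨i, j⟩ | π
    · simp only [value_succ_compare hs]
      exact add_le_add (hd h i j hs) (add_le_add (mul_le_mul_of_nonneg_left (ih _) (hq _ _))
        (mul_le_mul_of_nonneg_left (ih _) (hq _ _)))
    · simpa only [value_succ_output hs] using hF h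

theorem value_nonneg (hq : ∀ h b, 0 ≤ q h b) (hd : ∀ h, 0 ≤ d h) (hF : ∀ h, 0 ≤ F h) (m : ℕ)
    (h : List Bool) : 0 ≤ value s q d F m h := by
  induction m generalizing h with
  | zero => exact hF h
  | succ m ih =>
    rcases hs : s h with ⟨i, j⟩ | π
    · simp only [value_succ_compare hs]
      exact add_nonneg (hd h) (add_nonneg (mul_nonneg (hq _ _) (ih _))
        (mul_nonneg (hq _ _) (ih _)))
    · simpa only [value_succ_output hs] using hF h

theorem value_one_le (hq : ∀ h b, 0 ≤ q h b) (hsum : ∀ h, q h true + q h false ≤ 1) (m : ℕ)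
    (h : List Bool) : value s q 0 1 m h ≤ 1 := by
  induction m generalizing h with
  | zero => exact le_rfl
  | succ m ih =>
    rcases hs : s h with ⟨i, j⟩ | π
    · simp only [value_succ_compare hs, Pi.zero_apply, zero_add]
      have h1 := mul_le_mul_of_nonneg_left (ih (true :: h)) (hq h true)
      have h2 := mul_le_mul_of_nonneg_left (ih (false :: h)) (hq h false)
      linarith [hsum h]
    · simp only [value_succ_output hs, Pi.one_apply, le_refl]

/-- Change of measure: the Donsker–Varadhan-type bound for the accumulated relative entropy of
the answer weights `q` with respect to the answer weights `r`. -/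
theorem value_le_add_value_klDiv {r : List Bool → Bool → ℝ} (hq : ∀ h b, 0 < q h b)
    (hr : ∀ h b, 0 < r h b) (hsum : ∀ h, q h true + q h false = 1) (f : List Bool → ℝ) (m : ℕ)
    (h : List Bool) (l : ℝ) :
    value s q 0 f m h + 1 - Real.exp (-l) * value s r 0 (fun h => Real.exp (f h)) m h ≤
      l + value s q (fun h => q h true * Real.log (q h true / r h true) +
        q h false * Real.log (q h false / r h false)) 0 m h := by
  -- This is `x + 1 ≤ exp x` at `x = f h - l`.
  have base : ∀ h l, f h + 1 - Real.exp (-l) * Real.exp (f h) ≤ l + 0 := fun h l => by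
    rw [← Real.exp_add]
    linarith [Real.add_one_le_exp (-l + f h)]
  induction m generalizing h l with
  | zero => exact base h l
  | succ m ih =>
    rcases hs : s h with ⟨i, j⟩ | π
    · simp only [value_succ_compare hs, Pi.zero_apply, zero_add]
      -- The free parameter `l` absorbs the log-likelihood ratio: the induction hypothesis is used
      -- at `l + log (q / r)`, and `q * exp (-(l + log (q / r))) = r * exp (-l)`.
      have key : ∀ b, q h b * (value s q 0 f m (b :: h) + 1) -
          Real.exp (-l) * (r h b * value s r 0 (fun h => Real.exp (f h)) m (b :: h)) ≤
          q h b * (l + Real.log (q h b / r h b) + value s q (fun h =>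
            q h true * Real.log (q h true / r h true) +
            q h false * Real.log (q h false / r h false)) 0 m (b :: h)) := fun b => by
        refine le_trans (le_of_eq ?_)
          (mul_le_mul_of_nonneg_left (ih (b :: h) (l + Real.log (q h b / r h b))) (hq h b).le)
        rw [neg_add, Real.exp_add, ← Real.log_inv, Real.exp_log (by
          have := hq h b; have := hr h b; positivity)]
        have := (hq h b).ne'
        have := (hr h b).ne'
        field_simp
      have h1 := key true
      have h2 := key false
      have h3 := hsum h
      have h4 : q h true = 1 - q h false := by linarith
      rw [h4] at h1 ⊢
      linarith
    · simp only [value_succ_output hs]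
      exact base h l

/-- The indicator of the event that the strategy outputs the inverse of `τ`. -/
def hit (s : Strategy n) (τ : Equiv.Perm (Fin n)) (h : List Bool) : ℝ :=
  match s h with
  | .output π => if π = τ⁻¹ then 1 else 0
  | .compare _ _ => 0

theorem hit_nonneg (τ : Equiv.Perm (Fin n)) (h : List Bool) : 0 ≤ hit s τ h := by
  unfold hit; split
  · split_ifs <;> norm_num
  · exact le_rfl

theorem hit_eq_zero_or_one (τ : Equiv.Perm (Fin n)) (h : List Bool) :
    hit s τ h = 0 ∨ hit s τ h = 1 := by
  unfold hit; split
  · split_ifs <;> simp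
  · simp

theorem sum_hit_le_one {ι : Type*} (t : Finset ι) (τ : ι → Equiv.Perm (Fin n))
    (hτ : Function.Injective τ) (h : List Bool) : ∑ k ∈ t, hit s (τ k) h ≤ 1 := by
  classical
  rcases hs : s h with ⟨i, j⟩ | π
  · simp [hit, hs]
  · simp only [hit, hs]
    rw [Finset.sum_boole]
    have : (t.filter fun k => π = (τ k)⁻¹).card ≤ 1 := by
      rw [Finset.card_le_one]
      intro a ha b hb
      simp only [Finset.mem_filter] at ha hb
      exact hτ (inv_injective (ha.2.symm.trans hb.2))
    exact_mod_cast this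

/-- The change of measure bound for the event of outputting `τ⁻¹`. -/
theorem mul_value_hit_le {r : List Bool → Bool → ℝ} (hq : ∀ h b, 0 < q h b)
    (hr : ∀ h b, 0 < r h b) (hsum : ∀ h, q h true + q h false = 1)
    (hrsum : ∀ h, r h true + r h false ≤ 1) (τ : Equiv.Perm (Fin n)) {c : ℝ} (m : ℕ)
    (h : List Bool) :
    c * value s q 0 (hit s τ) m h - (Real.exp c - 1) * value s r 0 (hit s τ) m h ≤
      value s q (fun h => q h true * Real.log (q h true / r h true) +
        q h false * Real.log (q h false / r h false)) 0 m h := by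
  have h1 := value_le_add_value_klDiv (s := s) hq hr hsum (fun h => c * hit s τ h) m h 0
  have h2 : value s q 0 (fun h => c * hit s τ h) m h = c * value s q 0 (hit s τ) m h := by
    simpa [Pi.zero_def] using
      value_linear (s := s) (q := q) (d := 0) (F := hit s τ) (d' := 0) (F' := 0) c 0 m h
  -- As `hit` only takes the values 0 and 1, `exp (c * hit) = 1 + (exp c - 1) * hit`; the total mass
  -- of `r` is at most 1 and cancels the `+ 1` in `h1`.
  have h3 : value s r 0 (fun h => Real.exp (c * hit s τ h)) m h =
      1 * value s r 0 1 m h + (Real.exp c - 1) * value s r 0 (hit s τ) m h := by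
    rw [← value_linear]
    congr 1
    · ext; simp
    · ext h
      rcases hit_eq_zero_or_one (s := s) τ h with h0 | h0 <;> simp [h0]
  have h4 := value_one_le (s := s) (fun h b => (hr h b).le) hrsum m h
  rw [h2, h3] at h1
  simp only [neg_zero, Real.exp_zero, one_mul, zero_add] at h1
  linarith

end Value

/-- The probability of the answer `b` to a query, when element `i` has rank `σ i`. -/
noncomputable def answerWeight {n : ℕ} (p : ℝ) (s : Strategy n) (σ : Equiv.Perm (Fin n))
    (h : List Bool) (b : Bool) : ℝ :=
  match s h with
  -- A default that `value` never uses; it keeps the weights positive with sum 1 at every history.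
  | .output _ => 1 / 2
  | .compare i j => if b = decide (σ i < σ j) then 1 - p else p

section AnswerWeight

variable {n : ℕ} {s : Strategy n} {p : ℝ}

theorem answerWeight_pos (h0 : 0 < p) (h1 : p < 1) (σ : Equiv.Perm (Fin n)) (h : List Bool)
    (b : Bool) : 0 < answerWeight p s σ h b := by
  unfold answerWeight; split
  · norm_num
  · split_ifs <;> linarith

theorem answerWeight_add (σ : Equiv.Perm (Fin n)) (h : List Bool) :
    answerWeight p s σ h true + answerWeight p s σ h false = 1 := by
  unfold answerWeight; split
  · norm_num
  · rename_i i j _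
    by_cases hlt : σ i < σ j <;> simp [hlt]

end AnswerWeight

/-- `1` if `y` is the successor of `x`, `2` if `x` is the successor of `y`, otherwise `0`. -/
def adjType {n : ℕ} (x y : Fin n) : Fin 3 :=
  if (x : ℕ) + 1 = y then 1 else if (y : ℕ) + 1 = x then 2 else 0

/-- The indicator of a query comparing elements of neighbouring ranks. -/
def adjCost {n : ℕ} (s : Strategy n) (σ : Equiv.Perm (Fin n)) (h : List Bool) : ℝ :=
  match s h with
  | .output _ => 0
  | .compare i j => if adjType (σ i) (σ j) = 0 then 0 else 1

/-! ### Comparisons of neighbouring ranks: adjacent transpositions -/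

section Adjacent

variable {N : ℕ}

theorem swap_castSucc_succ_lt_iff (k : Fin N) (x y : Fin (N + 1))
    (h1 : ¬ (x = k.castSucc ∧ y = k.succ)) (h2 : ¬ (y = k.castSucc ∧ x = k.succ)) :
    Equiv.swap k.castSucc k.succ x < Equiv.swap k.castSucc k.succ y ↔ x < y := by
  simp only [Equiv.swap_apply_def]
  split_ifs <;> simp only [Fin.lt_def, Fin.ext_iff, Fin.val_castSucc, Fin.val_succ] at * <;> omega

theorem swap_castSucc_succ_injective :
    Function.Injective fun k : Fin N => Equiv.swap k.castSucc k.succ := by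
  intro k l hkl
  by_contra hne
  have h1 := congrArg (fun e => e k.castSucc) hkl
  simp only [Equiv.swap_apply_left, Equiv.swap_apply_def] at h1
  split_ifs at h1 <;> simp_all [Fin.ext_iff]
  omega

/-- The indicator of a query comparing the elements of ranks `k` and `k + 1`. -/
def pairCost (s : Strategy (N + 1)) (σ : Equiv.Perm (Fin (N + 1))) (k : Fin N) (h : List Bool) :
    ℝ :=
  match s h with
  | .output _ => 0
  | .compare i j => if (σ i = k.castSucc ∧ σ j = k.succ) ∨ (σ j = k.castSucc ∧ σ i = k.succ)
      then 1 else 0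

theorem sum_pairCost_le (s : Strategy (N + 1)) (σ : Equiv.Perm (Fin (N + 1))) (h : List Bool) :
    ∑ k, pairCost s σ k h ≤ adjCost s σ h := by
  rcases hs : s h with ⟨i, j⟩ | π
  · simp only [pairCost, adjCost, hs]
    rw [Finset.sum_boole]
    split_ifs with hadj
    · have : (Finset.univ.filter fun k : Fin N => (σ i = k.castSucc ∧ σ j = k.succ) ∨
          (σ j = k.castSucc ∧ σ i = k.succ)) = ∅ := by
        ext k
        simp only [Finset.mem_filter, Finset.mem_univ, true_and, Finset.notMem_empty, iff_false]
        rintro (⟨h1, h2⟩ | ⟨h1, h2⟩)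
        · simp [adjType, h1, h2] at hadj
        · simp only [adjType, h1, h2, Fin.val_castSucc, Fin.val_succ] at hadj
          split_ifs at hadj <;> simp_all
      simp [this]
    · have : (Finset.univ.filter fun k : Fin N => (σ i = k.castSucc ∧ σ j = k.succ) ∨
          (σ j = k.castSucc ∧ σ i = k.succ)).card ≤ 1 := by
        rw [Finset.card_le_one]
        intro a ha b hb
        simp only [Finset.mem_filter, Finset.mem_univ, true_and, Fin.ext_iff, Fin.val_castSucc,
          Fin.val_succ] at ha hb ⊢
        omega
      exact_mod_cast this
  · simp [pairCost, adjCost, hs]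

/-- An adjacent transposition of ranks reverses the order of that pair only. A query of it has its
Bernoulli parameters `p` and `1 - p` exchanged; for any other query the two laws agree. -/
theorem klDiv_swap_eq {s : Strategy (N + 1)} {p : ℝ} (h1 : p < 1)
    (σ : Equiv.Perm (Fin (N + 1))) (k : Fin N) (h : List Bool) :
    answerWeight p s σ h true * Real.log (answerWeight p s σ h true /
        answerWeight p s (Equiv.swap k.castSucc k.succ * σ) h true) +
      answerWeight p s σ h false * Real.log (answerWeight p s σ h false /
        answerWeight p s (Equiv.swap k.castSucc k.succ * σ) h false) =
      ((1 - 2 * p) * Real.log ((1 - p) / p)) * pairCost s σ k h := by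
  rcases hs : s h with ⟨i, j⟩ | π
  · simp only [answerWeight, pairCost, hs, Equiv.Perm.mul_apply]
    have hp1 : 1 - p ≠ 0 := by linarith
    have hl : Real.log (p / (1 - p)) = - Real.log ((1 - p) / p) := by
      rw [← Real.log_inv, inv_div]
    have hk : k.castSucc < k.succ := Fin.castSucc_lt_succ
    have hk' : ¬ k.succ < k.castSucc := not_lt_of_gt hk
    by_cases hc : (σ i = k.castSucc ∧ σ j = k.succ) ∨ (σ j = k.castSucc ∧ σ i = k.succ)
    · rw [if_pos hc]
      rcases hc with ⟨hi, hj⟩ | ⟨hj, hi⟩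
      · simp only [hi, hj, hk, hk', hl, Equiv.swap_apply_left, Equiv.swap_apply_right,
          decide_true, decide_false, if_true, if_false, reduceCtorEq]
        ring
      · simp only [hi, hj, hk, hk', hl, Equiv.swap_apply_left, Equiv.swap_apply_right,
          decide_true, decide_false, if_true, if_false, reduceCtorEq]
        ring
    · rw [if_neg hc, mul_zero]
      rw [not_or] at hc
      simp only [swap_castSucc_succ_lt_iff k _ _ hc.1 hc.2]
      have : ∀ x : ℝ, Real.log (x / x) = 0 := fun x => by
        by_cases hx : x = 0 <;> simp [hx]
      simp [this]
  · simp [answerWeight, pairCost, hs]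

/-- Lower bound for the number of comparisons of elements of neighbouring ranks. -/
theorem log_mul_sum_hit_le_adj (s : Strategy (N + 1)) {p : ℝ} (h0 : 0 < p) (h1 : p < 1) (m : ℕ) :
    N * Real.log (N + 1) *
        ∑ σ, value s (answerWeight p s σ) 0 (hit s σ) m [] - N * (N + 1).factorial ≤
      ∑ σ, ((1 - 2 * p) * Real.log ((1 - p) / p)) *
        value s (answerWeight p s σ) (adjCost s σ) 0 m [] := by
  set D := (1 - 2 * p) * Real.log ((1 - p) / p) with hD
  set V := fun σ τ => value s (answerWeight p s σ) 0 (hit s τ) m [] with hV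
  have hpair : ∀ σ (k : Fin N), Real.log (N + 1) * V σ σ -
      N * V (Equiv.swap k.castSucc k.succ * σ) σ ≤
        D * value s (answerWeight p s σ) (pairCost s σ k) 0 m [] := by
    intro σ k
    -- The choice `c = log (N + 1)` gives `exp c - 1 = N`, which balances the `N` alternatives.
    have h := mul_value_hit_le (s := s) (answerWeight_pos (s := s) h0 h1 σ)
      (answerWeight_pos (s := s) h0 h1 (Equiv.swap k.castSucc k.succ * σ)) (answerWeight_add σ)
      (fun h => (answerWeight_add _ h).le) σ (c := Real.log (N + 1)) m []
    rw [Real.exp_log (by positivity), add_sub_cancel_right] at h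
    simp only [klDiv_swap_eq h1] at h
    refine h.trans (le_of_eq ?_)
    have := value_linear (s := s) (q := answerWeight p s σ) (d := pairCost s σ k) (F := 0)
      (d' := 0) (F' := 0) D 0 m []
    simpa [Pi.zero_def] using this
  have hswap : ∑ σ, ∑ k : Fin N, V (Equiv.swap k.castSucc k.succ * σ) σ ≤
      (N + 1).factorial := by
    -- The transposition is an involution, so reindexing turns "wrong input, fixed output" into
    -- "fixed input, `N` distinct outputs", which are disjoint events.
    have h2 : ∀ k : Fin N, ∑ σ, V (Equiv.swap k.castSucc k.succ * σ) σ =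
        ∑ σ, V σ (Equiv.swap k.castSucc k.succ * σ) := fun k => by
      rw [← Equiv.sum_comp (Equiv.mulLeft (Equiv.swap k.castSucc k.succ))]
      simp [← mul_assoc]
    rw [Finset.sum_comm]
    simp only [h2]
    rw [Finset.sum_comm]
    have h3 : ∀ σ, ∑ k : Fin N, V σ (Equiv.swap k.castSucc k.succ * σ) ≤ 1 := fun σ => by
      have hq := fun h b => (answerWeight_pos (s := s) h0 h1 σ h b).le
      refine le_trans ?_ (value_one_le (s := s) hq (fun h => (answerWeight_add σ h).le) m [])
      rw [hV, ← value_sum]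
      refine value_mono hq (fun h i j _ => by simp) (fun h => ?_) m []
      exact sum_hit_le_one _ (fun k : Fin N => Equiv.swap k.castSucc k.succ * σ)
        (fun a b hab => swap_castSucc_succ_injective (mul_right_cancel hab)) h
    refine (Finset.sum_le_sum fun σ _ => h3 σ).trans (le_of_eq ?_)
    simp [Fintype.card_perm]
  have hadj : ∀ σ, ∑ k : Fin N, value s (answerWeight p s σ) (pairCost s σ k) 0 m [] ≤
      value s (answerWeight p s σ) (adjCost s σ) 0 m [] := fun σ => by
    rw [← value_sum]
    exact value_mono (fun h b => (answerWeight_pos h0 h1 σ h b).le)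
      (fun h _ _ _ => sum_pairCost_le s σ h) (fun h => by simp) m []
  have hDnn : 0 ≤ D := by
    rcases le_total p (1 / 2) with hp | hp
    · exact mul_nonneg (by linarith) (Real.log_nonneg (by rw [le_div_iff₀ h0]; linarith))
    · exact mul_nonneg_of_nonpos_of_nonpos (by linarith)
        (Real.log_nonpos (div_nonneg (by linarith) h0.le) (by rw [div_le_one h0]; linarith))
  have hsum : ∀ σ, N * (Real.log (N + 1) * V σ σ) -
      N * ∑ k : Fin N, V (Equiv.swap k.castSucc k.succ * σ) σ ≤
        D * value s (answerWeight p s σ) (adjCost s σ) 0 m [] := fun σ => by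
    refine le_trans ?_ (mul_le_mul_of_nonneg_left (hadj σ) hDnn)
    rw [Finset.mul_sum, Finset.mul_sum]
    refine le_trans (le_of_eq ?_) (Finset.sum_le_sum fun k _ => hpair σ k)
    simp
  refine le_trans ?_ (Finset.sum_le_sum fun σ _ => hsum σ)
  rw [Finset.sum_sub_distrib, ← Finset.mul_sum, ← Finset.mul_sum, ← Finset.mul_sum, ← mul_assoc]
  exact sub_le_sub_left (mul_le_mul_of_nonneg_left hswap N.cast_nonneg) _

end Adjacent

/-! ### Comparisons of other ranks: the genie's reference measure -/

section Genie

variable {n : ℕ}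

/-- The pairs that were queried before the history `h` was reached. -/
def queried (s : Strategy n) : List Bool → Finset (Fin n × Fin n)
  | [] => ∅
  | _ :: h =>
    match s h with
    | .output _ => queried s h
    | .compare i j => insert (i, j) (queried s h)

/-- The weight that the reference measure gives to the reply `(x, b)` to a query, where the genie
reveals, for a pair that was not queried before, the adjacency type `x`, and where `b` is the
noisy answer. -/
noncomputable def genieFactor (p ρ : ℝ) (known : Prop) [Decidable known] (x : Fin 3) (b : Bool) :
    ℝ :=
  (if known then 1 else if x = 0 then 1 - ρ else ρ / 2) *
    (if x = 0 then 1 / 2 else if b = decide (x = 1) then 1 - p else p)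

/-- The weight that the reference measure gives to the answer `b`, jointly with what the genie
reveals if the ranks are given by `σ`. -/
noncomputable def genieWeight (p ρ : ℝ) (s : Strategy n) (σ : Equiv.Perm (Fin n)) (h : List Bool)
    (b : Bool) : ℝ :=
  match s h with
  | .output _ => 1 / 2
  | .compare i j => genieFactor p ρ ((i, j) ∈ queried s h) (adjType (σ i) (σ j)) b

variable {p ρ : ℝ} {s : Strategy n}

theorem genieFactor_pos (h0 : 0 < p) (h1 : p < 1) (hρ0 : 0 < ρ) (hρ1 : ρ < 1) (known : Prop)
    [Decidable known] (x : Fin 3) (b : Bool) : 0 < genieFactor p ρ known x b := by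
  unfold genieFactor
  apply mul_pos <;> split_ifs <;> linarith

theorem genieWeight_pos (h0 : 0 < p) (h1 : p < 1) (hρ0 : 0 < ρ) (hρ1 : ρ < 1)
    (σ : Equiv.Perm (Fin n)) (h : List Bool) (b : Bool) : 0 < genieWeight p ρ s σ h b := by
  unfold genieWeight
  split
  · norm_num
  · exact genieFactor_pos h0 h1 hρ0 hρ1 _ _ _

theorem genieFactor_add (known : Prop) [Decidable known] (x : Fin 3) :
    genieFactor p ρ known x true + genieFactor p ρ known x false =
      if known then 1 else if x = 0 then 1 - ρ else ρ / 2 := by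
  unfold genieFactor
  rw [← mul_add]
  by_cases hx : x = 0
  · simp [hx]; norm_num
  · by_cases hx1 : x = 1 <;> simp [hx, hx1]

theorem genieWeight_add_le (hρ0 : 0 < ρ) (hρ1 : ρ < 1) (σ : Equiv.Perm (Fin n)) (h : List Bool) :
    genieWeight p ρ s σ h true + genieWeight p ρ s σ h false ≤ 1 := by
  unfold genieWeight
  split
  · norm_num
  · rw [genieFactor_add]
    split_ifs <;> linarith

/-- Under the reference measure the replies carry no information about the ranks. -/
theorem sum_value_genieWeight_hit_le_one (h0 : 0 < p) (h1 : p < 1) (hρ0 : 0 < ρ) (hρ1 : ρ < 1)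
    (m : ℕ) (h : List Bool) (S : Finset (Equiv.Perm (Fin n)))
    (hS : ∀ σ ∈ S, ∀ τ ∈ S, ∀ e ∈ queried s h, adjType (σ e.1) (σ e.2) = adjType (τ e.1) (τ e.2)) :
    ∑ σ ∈ S, value s (genieWeight p ρ s σ) 0 (hit s σ) m h ≤ 1 := by
  classical
  induction m generalizing h S with
  | zero => exact sum_hit_le_one S id Function.injective_id h
  | succ m ih =>
    rcases hs : s h with ⟨i, j⟩ | π
    · simp only [value_succ_compare hs, Pi.zero_apply, zero_add]
      -- By `hS`, all of `S` fits one and the same transcript of the genie. The next reply `(x, b)`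
      -- has the same weight for every member of the fibre `T x`, and that fibre again fits one
      -- transcript.
      set T : Fin 3 → Finset (Equiv.Perm (Fin n)) := fun x =>
        S.filter fun σ => adjType (σ i) (σ j) = x with hT
      have hfib : ∀ x b, ∑ σ ∈ T x, genieWeight p ρ s σ h b *
          value s (genieWeight p ρ s σ) 0 (hit s σ) m (b :: h) ≤
          genieFactor p ρ ((i, j) ∈ queried s h) x b := by
        intro x b
        have : ∀ σ ∈ T x, genieWeight p ρ s σ h b *
            value s (genieWeight p ρ s σ) 0 (hit s σ) m (b :: h) =
            genieFactor p ρ ((i, j) ∈ queried s h) x b *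
              value s (genieWeight p ρ s σ) 0 (hit s σ) m (b :: h) := fun σ hσ => by
          rw [hT, Finset.mem_filter] at hσ
          rw [← hσ.2]
          simp only [genieWeight, hs]
        rw [Finset.sum_congr rfl this, ← Finset.mul_sum]
        refine mul_le_of_le_one_right (genieFactor_pos h0 h1 hρ0 hρ1 _ _ _).le (ih _ _ ?_)
        intro σ hσ τ hτ e he
        rw [hT, Finset.mem_filter] at hσ hτ
        simp only [queried, hs, Finset.mem_insert] at he
        rcases he with rfl | he
        · exact hσ.2.trans hτ.2.symm
        · exact hS σ hσ.1 τ hτ.1 e he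
      have hfib2 : ∀ x, ∑ σ ∈ T x, (genieWeight p ρ s σ h true *
          value s (genieWeight p ρ s σ) 0 (hit s σ) m (true :: h) + genieWeight p ρ s σ h false *
          value s (genieWeight p ρ s σ) 0 (hit s σ) m (false :: h)) ≤
          if (i, j) ∈ queried s h then 1 else if x = 0 then 1 - ρ else ρ / 2 := fun x => by
        rw [Finset.sum_add_distrib, ← genieFactor_add (p := p)]
        exact add_le_add (hfib x true) (hfib x false)
      -- For a known pair there is a single fibre, of weight 1; for a new pair the weights of the
      -- three fibres are `1 - ρ`, `ρ / 2` and `ρ / 2`.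
      by_cases hk : (i, j) ∈ queried s h
      · rcases S.eq_empty_or_nonempty with rfl | ⟨τ, hτ⟩
        · simp
        · have hTS : T (adjType (τ i) (τ j)) = S := by
            rw [hT, Finset.filter_eq_self]
            exact fun σ hσ => hS σ hσ τ hτ (i, j) hk
          have := hfib2 (adjType (τ i) (τ j))
          rwa [hTS, if_pos hk] at this
      · simp only [if_neg hk] at hfib2
        rw [← Finset.sum_fiberwise S (fun σ => adjType (σ i) (σ j))]
        refine (Finset.sum_le_sum fun x _ => hfib2 x).trans (le_of_eq ?_)
        rw [Fin.sum_univ_three]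
        simp only [reduceIte, one_ne_zero, Fin.reduceEq]
        ring
    · simp only [value_succ_output hs]
      exact sum_hit_le_one S id Function.injective_id h

/-- The indicator of a query comparing elements of ranks that are not neighbouring. -/
def nonadjCost (s : Strategy n) (σ : Equiv.Perm (Fin n)) (h : List Bool) : ℝ :=
  match s h with
  | .output _ => 0
  | .compare i j => if adjType (σ i) (σ j) = 0 then 1 else 0

/-- The indicator of the first query of a pair of elements of neighbouring ranks. -/
def newAdjCost (s : Strategy n) (σ : Equiv.Perm (Fin n)) (h : List Bool) : ℝ :=
  match s h with
  | .output _ => 0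
  | .compare i j => if adjType (σ i) (σ j) ≠ 0 ∧ (i, j) ∉ queried s h then 1 else 0

/-- The number of neighbouring pairs not yet queried is a potential: every charged query lowers it
by at least 1, and no query raises it. -/
theorem value_newAdjCost_le_card {q : List Bool → Bool → ℝ} (hq : ∀ h b, 0 ≤ q h b)
    (hsum : ∀ h, q h true + q h false = 1) (σ : Equiv.Perm (Fin n)) (m : ℕ) (h : List Bool) :
    value s q (newAdjCost s σ) 0 m h ≤
      (Finset.univ.filter fun e : Fin n × Fin n =>
        adjType (σ e.1) (σ e.2) ≠ 0 ∧ e ∉ queried s h).card := by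
  induction m generalizing h with
  | zero => exact Nat.cast_nonneg _
  | succ m ih =>
    rcases hs : s h with ⟨i, j⟩ | π
    · rw [value_succ_compare hs]
      set X := fun h => Finset.univ.filter fun e : Fin n × Fin n =>
        adjType (σ e.1) (σ e.2) ≠ 0 ∧ e ∉ queried s h with hX
      have hstep : ∀ b, newAdjCost s σ h + (X (b :: h)).card ≤ (X h).card := by
        intro b
        simp only [newAdjCost, hs]
        have hsub : X (b :: h) ⊆ X h := by
          intro e
          simp only [hX, queried, hs, Finset.mem_filter, Finset.mem_univ, true_and,
            Finset.mem_insert, not_or]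
          tauto
        split_ifs with hnew
        · have : (X (b :: h)).card < (X h).card := by
            refine Finset.card_lt_card (hsub.ssubset_of_ne fun heq => ?_)
            have hmem : (i, j) ∈ X h := by simpa [hX] using hnew
            rw [← heq] at hmem
            simp [hX, queried, hs] at hmem
          rw [add_comm]
          exact_mod_cast this
        · rw [zero_add]
          exact_mod_cast Finset.card_le_card hsub
      have h1 := mul_le_mul_of_nonneg_left ((ih (true :: h)).trans
        (le_sub_iff_add_le'.2 (hstep true))) (hq h true)
      have h2 := mul_le_mul_of_nonneg_left ((ih (false :: h)).trans
        (le_sub_iff_add_le'.2 (hstep false))) (hq h false)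
      have h3 : q h true = 1 - q h false := by linarith [hsum h]
      rw [h3] at h1 ⊢
      linarith
    · rw [value_succ_output hs]
      exact Nat.cast_nonneg _

theorem card_adjType_ne_zero_le (σ : Equiv.Perm (Fin n)) :
    (Finset.univ.filter fun e : Fin n × Fin n => adjType (σ e.1) (σ e.2) ≠ 0).card ≤ 2 * n := by
  classical
  have hsub : (Finset.univ.filter fun e : Fin n × Fin n => adjType (σ e.1) (σ e.2) ≠ 0) ⊆
      (Finset.univ.filter fun e : Fin n × Fin n => (σ e.1 : ℕ) + 1 = σ e.2) ∪
        Finset.univ.filter fun e : Fin n × Fin n => (σ e.2 : ℕ) + 1 = σ e.1 := by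
    intro e
    simp only [Finset.mem_union, Finset.mem_filter, Finset.mem_univ, true_and]
    intro he
    by_contra hne
    rw [not_or] at hne
    exact he (by rw [adjType, if_neg hne.1, if_neg hne.2])
  have hA : (Finset.univ.filter fun e : Fin n × Fin n => (σ e.1 : ℕ) + 1 = σ e.2).card ≤ n := by
    conv_rhs => rw [← Finset.card_fin n]
    refine Finset.card_le_card_of_injOn Prod.fst (fun _ _ => Finset.mem_univ _) ?_
    intro a ha b hb hab
    simp only [Finset.coe_filter, Finset.mem_univ, true_and, Set.mem_ofPred_eq] at ha hb
    rw [hab] at ha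
    exact Prod.ext hab (σ.injective (Fin.ext (ha.symm.trans hb)))
  have hB : (Finset.univ.filter fun e : Fin n × Fin n => (σ e.2 : ℕ) + 1 = σ e.1).card ≤ n := by
    conv_rhs => rw [← Finset.card_fin n]
    refine Finset.card_le_card_of_injOn Prod.snd (fun _ _ => Finset.mem_univ _) ?_
    intro a ha b hb hab
    simp only [Finset.coe_filter, Finset.mem_univ, true_and, Set.mem_ofPred_eq] at ha hb
    rw [hab] at ha
    exact Prod.ext (σ.injective (Fin.ext (ha.symm.trans hb))) hab
  have := (Finset.card_le_card hsub).trans (Finset.card_union_le _ _)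
  omega

/-- For type 0 the noisy answer is measured against a fair coin, which costs `log 2 - h(p)`, and
predicting the type costs at most `-log (1 - ρ)`. For the other types the reference uses the true
noise, so only revealing the type costs, namely `log (2 / ρ)`, once per ordered pair. -/
theorem klDiv_genieWeight_le (h0 : 0 < p) (h1 : p < 1) (hρ0 : 0 < ρ) (hρ1 : ρ < 1)
    (σ : Equiv.Perm (Fin n)) {h : List Bool} {i j : Fin n} (hs : s h = .compare i j) :
    answerWeight p s σ h true * Real.log (answerWeight p s σ h true / genieWeight p ρ s σ h true) +
      answerWeight p s σ h false *
        Real.log (answerWeight p s σ h false / genieWeight p ρ s σ h false) ≤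
      (Real.log 2 - Real.binEntropy p - Real.log (1 - ρ)) * nonadjCost s σ h +
        Real.log (2 / ρ) * newAdjCost s σ h := by
  have hp : 0 < 1 - p := by linarith
  have hr : 0 < 1 - ρ := by linarith
  have hlog : Real.log (1 - ρ) ≤ 0 := Real.log_nonpos hr.le (by linarith)
  by_cases hx : adjType (σ i) (σ j) = 0
  · have hkl : ∀ f, 0 < f → (1 - p) * Real.log ((1 - p) / (f * (1 / 2))) +
        p * Real.log (p / (f * (1 / 2))) = Real.log 2 - Real.binEntropy p - Real.log f := by
      intro f hf
      rw [Real.log_div hp.ne' (by positivity), Real.log_div h0.ne' (by positivity),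
        Real.log_mul hf.ne' (by norm_num), one_div, Real.log_inv, Real.binEntropy, Real.log_inv,
        Real.log_inv]
      ring
    have hR : ∀ b, genieWeight p ρ s σ h b =
        (if (i, j) ∈ queried s h then 1 else 1 - ρ) * (1 / 2) := by
      intro b; simp [genieWeight, hs, genieFactor, hx]
    have hN : nonadjCost s σ h = 1 := by simp [nonadjCost, hs, hx]
    have hA : newAdjCost s σ h = 0 := by simp [newAdjCost, hs, hx]
    have hf : 0 < (if (i, j) ∈ queried s h then 1 else 1 - ρ) := by split_ifs <;> linarith
    have hle : Real.log (1 - ρ) ≤ Real.log (if (i, j) ∈ queried s h then 1 else 1 - ρ) := by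
      split_ifs
      · simpa using hlog
      · exact le_rfl
    have := hkl _ hf
    rw [hR, hR, hN, hA]
    by_cases hlt : σ i < σ j
    · simp only [answerWeight, hs, hlt, decide_true, if_true, reduceCtorEq, if_false]
      linarith
    · simp only [answerWeight, hs, hlt, decide_false, if_true, reduceCtorEq, if_false]
      linarith
  -- For neighbouring ranks the type determines the true order.
  · have hdec : decide (σ i < σ j) = decide (adjType (σ i) (σ j) = 1) := by
      simp only [adjType, Fin.lt_def] at hx ⊢
      split_ifs at hx ⊢ <;> simp_all <;> omega
    have hR : ∀ b, genieWeight p ρ s σ h b =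
        (if (i, j) ∈ queried s h then 1 else ρ / 2) * answerWeight p s σ h b := by
      intro b; simp [genieWeight, answerWeight, hs, genieFactor, hx, hdec]
    have hN : nonadjCost s σ h = 0 := by simp [nonadjCost, hs, hx]
    have hA : newAdjCost s σ h = if (i, j) ∈ queried s h then 0 else 1 := by
      by_cases hk : (i, j) ∈ queried s h <;> simp [newAdjCost, hs, hx, hk]
    have hquot : ∀ b, answerWeight p s σ h b / genieWeight p ρ s σ h b =
        if (i, j) ∈ queried s h then 1 else 2 / ρ := fun b => by
      have := (answerWeight_pos (s := s) h0 h1 σ h b).ne'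
      rw [hR]
      split_ifs <;> field_simp
    rw [hquot, hquot, hN, hA, ← add_mul, answerWeight_add]
    split_ifs <;> simp

/-- Lower bound for the number of comparisons of elements of ranks that are not neighbouring. -/
theorem log_factorial_mul_sum_hit_le_nonadj (s : Strategy n) (h0 : 0 < p) (h1 : p < 1)
    (hρ0 : 0 < ρ) (hρ1 : ρ < 1) (m : ℕ) :
    Real.log n.factorial * ∑ σ, value s (answerWeight p s σ) 0 (hit s σ) m [] -
        n.factorial * (1 + 2 * n * Real.log (2 / ρ)) ≤
      ∑ σ, (Real.log 2 - Real.binEntropy p - Real.log (1 - ρ)) *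
        value s (answerWeight p s σ) (nonadjCost s σ) 0 m [] := by
  set J := Real.log 2 - Real.binEntropy p - Real.log (1 - ρ) with hJ
  have hlog : 0 ≤ Real.log (2 / ρ) := Real.log_nonneg (by rw [le_div_iff₀ hρ0]; linarith)
  have hσ : ∀ σ, Real.log n.factorial * value s (answerWeight p s σ) 0 (hit s σ) m [] -
      n.factorial * value s (genieWeight p ρ s σ) 0 (hit s σ) m [] -
        2 * n * Real.log (2 / ρ) ≤ J * value s (answerWeight p s σ) (nonadjCost s σ) 0 m [] := by
    intro σ
    have hq := fun h b => (answerWeight_pos (s := s) h0 h1 σ h b).le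
    have hfac : (0 : ℝ) < n.factorial := by exact_mod_cast n.factorial_pos
    -- With `exp c = n!`, the reference terms summed over all `σ` contribute at most `n!`.
    have hkl := mul_value_hit_le (s := s) (answerWeight_pos (s := s) h0 h1 σ)
      (genieWeight_pos (s := s) h0 h1 hρ0 hρ1 σ) (answerWeight_add σ)
      (genieWeight_add_le hρ0 hρ1 σ) σ (c := Real.log n.factorial) m []
    rw [Real.exp_log hfac] at hkl
    have hG : 0 ≤ value s (genieWeight p ρ s σ) 0 (hit s σ) m [] :=
      value_nonneg (fun h b => (genieWeight_pos h0 h1 hρ0 hρ1 σ h b).le) (fun _ => le_rfl)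
        (hit_nonneg σ) m []
    have hup := value_mono (s := s) (F := 0) (F' := 0) hq
      (fun h i j hs => klDiv_genieWeight_le (p := p) h0 h1 hρ0 hρ1 σ hs) (fun h => le_rfl) m []
    have hlin := value_linear (s := s) (q := answerWeight p s σ) (d := nonadjCost s σ)
      (d' := newAdjCost s σ) (F := 0) (F' := 0) J (Real.log (2 / ρ)) m []
    simp only [Pi.zero_apply, mul_zero, add_zero, ← Pi.zero_def] at hlin
    have hcard : value s (answerWeight p s σ) (newAdjCost s σ) 0 m [] ≤ 2 * n := by
      refine (value_newAdjCost_le_card hq (answerWeight_add σ) σ m []).trans ?_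
      have := card_adjType_ne_zero_le σ
      simp only [queried, Finset.notMem_empty, not_false_eq_true, and_true]
      exact_mod_cast this
    have := mul_le_mul_of_nonneg_left hcard hlog
    linarith
  have hsum := sum_value_genieWeight_hit_le_one (s := s) h0 h1 hρ0 hρ1 m [] Finset.univ
    (by simp [queried])
  refine le_trans ?_ (Finset.sum_le_sum fun σ _ => hσ σ)
  rw [Finset.sum_sub_distrib, Finset.sum_sub_distrib, ← Finset.mul_sum, ← Finset.mul_sum]
  simp only [Finset.sum_const, Finset.card_univ, Fintype.card_perm, Fintype.card_fin,
    nsmul_eq_mul]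
  have := mul_le_mul_of_nonneg_left hsum (Nat.cast_nonneg (α := ℝ) n.factorial)
  linarith

end Genie

/-! ### From decision trees to runs with random noise -/

section Noise

variable {n : ℕ}

instance : MeasurableSpace (List Bool) := ⊤

instance : Countable (Move n) := by
  let f : Move n → (Fin n × Fin n) ⊕ Equiv.Perm (Fin n) := fun
    | .compare i j => .inl (i, j)
    | .output π => .inr π
  refine Function.Injective.countable (f := f) ?_
  rintro (⟨i, j⟩ | π) (⟨i', j'⟩ | π') h <;> simp_all [f]

/-- The history after the next step, if `b` is the next noise bit. -/
def nextHistory {α : Type*} [LinearOrder α] (a : Fin n → α) (mv : Move n) (b : Bool)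
    (h : List Bool) : List Bool :=
  match mv with
  | .output _ => h
  | .compare i j => xor (decide (a i < a j)) b :: h

section Measurability

variable {α : Type*} [LinearOrder α] {Ω : Type*} [MeasurableSpace Ω]

theorem answers_succ (s : Strategy n) (a : Fin n → α) (z : ℕ → Bool) (t : ℕ) :
    answers s a z (t + 1) = nextHistory a (s (answers s a z t)) (z t) (answers s a z t) := by
  rcases hs : s (answers s a z t) with ⟨i, j⟩ | π <;> simp [answers, nextHistory, hs]

theorem measurable_move {S : Ω → Strategy n} (hS : ∀ h, Measurable fun ω => S ω h)
    {X : Ω × (ℕ → Bool) → List Bool} (hX : Measurable X) :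
    Measurable fun x : Ω × (ℕ → Bool) => S x.1 (X x) := by
  have h : Measurable fun y : List Bool × Ω => S y.2 y.1 :=
    measurable_from_prod_countable_right hS
  exact h.comp (hX.prodMk measurable_fst)

theorem measurable_answers {S : Ω → Strategy n} (hS : ∀ h, Measurable fun ω => S ω h)
    (a : Fin n → α) (t : ℕ) :
    Measurable fun x : Ω × (ℕ → Bool) => answers (S x.1) a x.2 t := by
  induction t with
  | zero => exact measurable_const
  | succ t ih =>
    simp only [answers_succ]
    have h : Measurable fun y : Move n × Bool × List Bool => nextHistory a y.1 y.2.1 y.2.2 :=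
      Measurable.of_discrete
    exact h.comp ((measurable_move hS ih).prodMk
      (((measurable_pi_apply t).comp measurable_snd).prodMk ih))

theorem measurable_answers_const (s : Strategy n) (a : Fin n → α) (t : ℕ) :
    Measurable fun z => answers s a z t :=
  (measurable_answers (Ω := Unit) (S := fun _ => s) (fun _ => measurable_const) a t).comp
    (measurable_const.prodMk measurable_id : Measurable fun z : ℕ → Bool => ((), z))

theorem answers_congr (s : Strategy n) (a : Fin n → α) {z z' : ℕ → Bool} {t : ℕ}
    (h : ∀ i < t, z i = z' i) : answers s a z t = answers s a z' t := by
  induction t with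
  | zero => rfl
  | succ t ih =>
    rw [answers_succ, answers_succ, ih fun i hi => h i (hi.trans t.lt_succ_self),
      h t t.lt_succ_self]

/-- The first `t` steps read only the noise bits before `t`; `φ` pads the later ones with `false`.
-/
theorem indepFun_answers (p : unitInterval) (s : Strategy n) (a : Fin n → α) (t : ℕ) :
    IndepFun (fun z => answers s a z t) (fun z => z t) (noise p) := by
  have hind : iIndepFun (fun (i : ℕ) (z : ℕ → Bool) => z i) (noise p) :=
    iIndepFun_infinitePi (X := fun _ b => b) (fun _ => measurable_id)
  have h := hind.indepFun_finset (Finset.range t) {t} (by simp) (fun i => measurable_pi_apply i)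
  let φ : (Finset.range t → Bool) → List Bool := fun y =>
    answers s a (fun i => if hi : i ∈ Finset.range t then y ⟨i, hi⟩ else false) t
  let ψ : (({t} : Finset ℕ) → Bool) → Bool := fun y => y ⟨t, Finset.mem_singleton_self t⟩
  have h2 := h.comp (φ := φ) (ψ := ψ) Measurable.of_discrete Measurable.of_discrete
  have hφ : (fun z => answers s a z t) = φ ∘ fun z (i : Finset.range t) => z i := by
    ext1 z
    exact answers_congr s a fun i hi => by simp [hi]
  rw [hφ]
  exact h2

theorem lintegral_answers_noise (p : unitInterval) (s : Strategy n) (a : Fin n → α) (t : ℕ)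
    (G : List Bool → Bool → ℝ≥0∞) :
    ∫⁻ z, G (answers s a z t) (z t) ∂noise p =
      ∫⁻ z, (ENNReal.ofReal p * G (answers s a z t) true +
        ENNReal.ofReal (1 - p) * G (answers s a z t) false) ∂noise p := by
  have hX := measurable_answers_const s a t
  have hY : Measurable fun z : ℕ → Bool => z t := measurable_pi_apply t
  have : IsProbabilityMeasure (noise p) := by unfold noise; infer_instance
  have hG : Measurable (Function.uncurry G) := Measurable.of_discrete
  have hmap : (noise p).map (fun z => z t) = bernoulliMeasure true false p :=
    Measure.infinitePi_map_eval _ t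
  calc ∫⁻ z, G (answers s a z t) (z t) ∂noise p
      = ∫⁻ y, Function.uncurry G y ∂((noise p).map fun z => (answers s a z t, z t)) := by
        rw [lintegral_map hG (hX.prodMk hY)]; rfl
    _ = ∫⁻ h, ∫⁻ b, G h b ∂bernoulliMeasure true false p
          ∂((noise p).map fun z => answers s a z t) := by
        rw [(indepFun_iff_map_prod_eq_prod_map_map hX.aemeasurable hY.aemeasurable).1
          (indepFun_answers p s a t), hmap, lintegral_prod _ hG.aemeasurable]
        rfl
    _ = ∫⁻ h, (ENNReal.ofReal p * G h true + ENNReal.ofReal (1 - p) * G h false)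
          ∂((noise p).map fun z => answers s a z t) := by
        refine lintegral_congr fun h => ?_
        rw [bernoulliMeasure_def, lintegral_add_measure, lintegral_smul_measure,
          lintegral_smul_measure, lintegral_dirac, lintegral_dirac]
        congr 1
        · rw [ENNReal.smul_def, smul_eq_mul]
          congr 1
          rw [ENNReal.ofReal]
          congr 1
          exact (Real.toNNReal_of_nonneg p.2.1).symm
        · rw [ENNReal.smul_def, smul_eq_mul]
          congr 1
          rw [ENNReal.ofReal]
          congr 1
          exact (Real.toNNReal_of_nonneg (unitInterval.symm p).2.1).symm
    _ = _ := by rw [lintegral_map Measurable.of_discrete hX]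

end Measurability

/-- The cost `d` restricted to the histories at which a query is made. -/
def queryCost (s : Strategy n) (d : List Bool → ℝ) (h : List Bool) : ℝ :=
  match s h with
  | .output _ => 0
  | .compare _ _ => d h

/-- The recursion rewritten in terms of the noise bit instead of the answer. It also covers halted
histories, which stay fixed and where `value` does not depend on `m`. -/
theorem value_succ_eq {s : Strategy n} {p : ℝ} {σ : Equiv.Perm (Fin n)} {d F : List Bool → ℝ}
    (m : ℕ) (h : List Bool) :
    value s (answerWeight p s σ) d F (m + 1) h = queryCost s d h +
      (p * value s (answerWeight p s σ) d F m (nextHistory σ (s h) true h) +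
        (1 - p) * value s (answerWeight p s σ) d F m (nextHistory σ (s h) false h)) := by
  rcases hs : s h with ⟨i, j⟩ | π
  · rw [value_succ_compare hs]
    by_cases hlt : σ i < σ j
    · simp [queryCost, nextHistory, answerWeight, hs, hlt]; ring
    · simp [queryCost, nextHistory, answerWeight, hs, hlt]
  · have : value s (answerWeight p s σ) d F m h = F h := by
      cases m with
      | zero => rfl
      | succ m => exact value_succ_output hs
    rw [value_succ_output hs]
    simp only [queryCost, hs, nextHistory, this]
    ring

theorem lintegral_value {p : unitInterval} {s : Strategy n} (h0 : 0 < (p : ℝ)) (h1 : (p : ℝ) < 1)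
    (σ : Equiv.Perm (Fin n)) {d F : List Bool → ℝ} (hd : ∀ h, 0 ≤ d h) (hF : ∀ h, 0 ≤ F h)
    (m t : ℕ) :
    ∫⁻ z, ENNReal.ofReal (value s (answerWeight p s σ) d F m (answers s σ z t)) ∂noise p =
      ∑ u ∈ Finset.range m,
        ∫⁻ z, ENNReal.ofReal (queryCost s d (answers s σ z (t + u))) ∂noise p +
      ∫⁻ z, ENNReal.ofReal (F (answers s σ z (t + m))) ∂noise p := by
  induction m generalizing t with
  | zero => simp [value]
  | succ m ih =>
    set V := value s (answerWeight p s σ) d F m with hV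
    have hV0 : ∀ h, 0 ≤ V h := fun h =>
      value_nonneg (fun h b => (answerWeight_pos h0 h1 σ h b).le) hd hF m h
    have hq0 : ∀ h, 0 ≤ queryCost s d h := fun h => by
      unfold queryCost; split
      · exact le_rfl
      · exact hd h
    have hp1 : 0 ≤ 1 - (p : ℝ) := by linarith
    have hstep : ∀ z, ENNReal.ofReal
        (value s (answerWeight p s σ) d F (m + 1) (answers s σ z t)) =
        ENNReal.ofReal (queryCost s d (answers s σ z t)) +
        (ENNReal.ofReal p * ENNReal.ofReal
          (V (nextHistory σ (s (answers s σ z t)) true (answers s σ z t))) +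
        ENNReal.ofReal (1 - p) * ENNReal.ofReal
          (V (nextHistory σ (s (answers s σ z t)) false (answers s σ z t)))) := fun z => by
      rw [value_succ_eq, ENNReal.ofReal_add (hq0 _) (add_nonneg (mul_nonneg h0.le (hV0 _))
        (mul_nonneg hp1 (hV0 _))), ENNReal.ofReal_add (mul_nonneg h0.le (hV0 _))
        (mul_nonneg hp1 (hV0 _)), ENNReal.ofReal_mul h0.le, ENNReal.ofReal_mul hp1]
    have hmeas : Measurable fun z => ENNReal.ofReal (queryCost s d (answers s σ z t)) :=
      (Measurable.of_discrete (f := fun h => ENNReal.ofReal (queryCost s d h))).comp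
        (measurable_answers_const s σ t)
    have hnoise := lintegral_answers_noise p s σ t
      (fun h b => ENNReal.ofReal (V (nextHistory σ (s h) b h)))
    simp only [hstep]
    rw [lintegral_add_left hmeas, ← hnoise]
    simp only [← answers_succ]
    rw [ih (t + 1), Finset.sum_range_succ', add_zero]
    simp only [add_assoc, add_comm 1]
    exact add_left_comm _ _ _

/-- The only order automorphism of `Fin n` is the identity, so exactly one output is correct. -/
theorem monotone_perm_comp_iff (σ π : Equiv.Perm (Fin n)) :
    (Monotone fun k => σ (π k)) ↔ π = σ⁻¹ := by
  constructor
  · intro h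
    have h2 : StrictMono fun k => (σ * π) k := h.strictMono_of_injective (σ * π).injective
    have h3 : σ * π = 1 := by
      ext k
      have := congrArg (fun e : Fin n ≃o Fin n => e k) (Subsingleton.elim
        (h2.orderIsoOfSurjective _ (σ * π).surjective) (OrderIso.refl (Fin n)))
      simpa using congrArg Fin.val this
    exact eq_inv_of_mul_eq_one_right h3
  · rintro rfl a b hab
    simpa using hab

theorem succeeds_iff_exists_hit (s : Strategy n) (σ : Equiv.Perm (Fin n)) (z : ℕ → Bool) :
    Succeeds s σ z ↔ ∃ t, hit s σ (answers s σ z t) = 1 := by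
  unfold Succeeds
  simp only [monotone_perm_comp_iff]
  refine exists_congr fun t => ?_
  rcases hs : s (answers s σ z t) with ⟨i, j⟩ | π <;> simp [hit, hs]

theorem hit_answers_mono (s : Strategy n) (σ : Equiv.Perm (Fin n)) (z : ℕ → Bool) {t u : ℕ}
    (htu : t ≤ u) (h : hit s σ (answers s σ z t) = 1) : hit s σ (answers s σ z u) = 1 := by
  induction u, htu using Nat.le_induction with
  | base => exact h
  | succ u _ ih =>
    rw [answers_succ]
    rcases hs : s (answers s σ z u) with ⟨i, j⟩ | π
    · simp [hit, hs] at ih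
    · exact ih

/-- The probability of success is the limit of the probabilities of success within `m` steps. -/
theorem tendsto_value_hit {p : unitInterval} (s : Strategy n) (h0 : 0 < (p : ℝ))
    (h1 : (p : ℝ) < 1) (σ : Equiv.Perm (Fin n)) :
    Tendsto (fun m => ENNReal.ofReal (value s (answerWeight p s σ) 0 (hit s σ) m [])) atTop
      (𝓝 (noise p {z | Succeeds s σ z})) := by
  have : IsProbabilityMeasure (noise p) := by unfold noise; infer_instance
  have hval : ∀ m, ENNReal.ofReal (value s (answerWeight p s σ) 0 (hit s σ) m []) =
      noise p {z | hit s σ (answers s σ z m) = 1} := fun m => by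
    have h := lintegral_value (s := s) h0 h1 σ (d := 0) (fun _ => le_rfl)
      (hit_nonneg (s := s) σ) m 0
    simp only [answers, lintegral_const, measure_univ, mul_one, zero_add] at h
    rw [h]
    have hz : ∀ z u, queryCost s 0 (answers s σ z u) = 0 := fun z u => by
      unfold queryCost; split <;> rfl
    simp only [hz, ENNReal.ofReal_zero, lintegral_zero, Finset.sum_const_zero, zero_add]
    have hmeas : MeasurableSet {z | hit s σ (answers s σ z m) = 1} :=
      measurable_answers_const s (⇑σ) m (MeasurableSet.of_discrete (s := {h | hit s σ h = 1}))
    rw [← lintegral_indicator_one hmeas]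
    refine lintegral_congr fun z => ?_
    rcases hit_eq_zero_or_one (s := s) σ (answers s σ z m) with h | h <;> simp [h]
  have hset : {z | Succeeds s σ z} = ⋃ m, {z | hit s σ (answers s σ z m) = 1} := by
    ext z
    simp [succeeds_iff_exists_hit]
  simp only [hval, hset]
  exact tendsto_measure_iUnion_atTop fun t u htu z hz => hit_answers_mono s σ z htu hz

theorem value_one_le_lintegral_queryCount {p : unitInterval} (s : Strategy n) (h0 : 0 < (p : ℝ))
    (h1 : (p : ℝ) < 1) (σ : Equiv.Perm (Fin n)) (m : ℕ) :
    ENNReal.ofReal (value s (answerWeight p s σ) 1 0 m []) ≤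
      ∫⁻ z, queryCount s σ z ∂noise p := by
  classical
  have : IsProbabilityMeasure (noise p) := by unfold noise; infer_instance
  have h := lintegral_value (s := s) h0 h1 σ (d := 1) (F := 0) (fun _ => zero_le_one)
    (fun _ => le_rfl) m 0
  simp only [answers, lintegral_const, measure_univ, mul_one, zero_add, Pi.zero_apply,
    ENNReal.ofReal_zero, add_zero] at h
  rw [h, ← lintegral_finsetSum]
  · refine lintegral_mono fun z => ?_
    unfold queryCount
    refine le_trans (le_of_eq (Finset.sum_congr rfl fun u _ => ?_))
      (ENNReal.sum_le_tsum (Finset.range m))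
    rcases hs : s (answers s σ z u) with ⟨i, j⟩ | π <;> simp [queryCost, hs]
  · intro u _
    exact (Measurable.of_discrete (f := fun h => ENNReal.ofReal (queryCost s 1 h))).comp
        (measurable_answers_const s σ u)

end Noise

/-! ### Adding the two bounds and removing the truncation -/

section LowerBound

variable {N : ℕ} {p ρ : ℝ}

theorem value_adjCost_add_value_nonadjCost_le {n : ℕ} (s : Strategy n) (h0 : 0 < p) (h1 : p < 1)
    (σ : Equiv.Perm (Fin n)) (m : ℕ) :
    value s (answerWeight p s σ) (adjCost s σ) 0 m [] +
      value s (answerWeight p s σ) (nonadjCost s σ) 0 m [] ≤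
        value s (answerWeight p s σ) 1 0 m [] := by
  have hlin := value_linear (s := s) (q := answerWeight p s σ) (d := adjCost s σ)
      (d' := nonadjCost s σ) (F := 0) (F' := 0) 1 1 m []
  rw [one_mul, one_mul] at hlin
  rw [← hlin]
  refine value_mono (fun h b => (answerWeight_pos h0 h1 σ h b).le) (fun h i j hs => ?_)
    (fun h => by simp) m []
  by_cases hx : adjType (σ i) (σ j) = 0 <;> simp [adjCost, nonadjCost, hs, hx]

/-- The expected number of comparisons within the first `m` steps, summed over all inputs, is
bounded below in terms of the probability of success within the first `m` steps. -/
theorem mul_sum_value_hit_le (s : Strategy (N + 1)) (h0 : 0 < p) (hp : p < 1 / 2)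
    (hρ0 : 0 < ρ) (hρ1 : ρ < 1) {D J : ℝ} (hD : D = (1 - 2 * p) * Real.log ((1 - p) / p))
    (hJ : J = Real.log 2 - Real.binEntropy p - Real.log (1 - ρ)) (hD0 : 0 < D) (hJ0 : 0 < J)
    (m : ℕ) :
    (N * Real.log (N + 1) / D + Real.log (N + 1).factorial / J) *
        ∑ σ, value s (answerWeight p s σ) 0 (hit s σ) m [] ≤
      ∑ σ, value s (answerWeight p s σ) 1 0 m [] +
        (N + 1).factorial * (N / D + (1 + 2 * (N + 1 : ℕ) * Real.log (2 / ρ)) / J) := by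
  have h1 : p < 1 := by linarith
  have hadj := log_mul_sum_hit_le_adj s h0 h1 m
  have hnon := log_factorial_mul_sum_hit_le_nonadj s h0 h1 hρ0 hρ1 m
  rw [← hD, ← Finset.mul_sum, mul_comm D, ← div_le_iff₀ hD0, sub_div, mul_div_right_comm] at hadj
  rw [← hJ, ← Finset.mul_sum, mul_comm J, ← div_le_iff₀ hJ0, sub_div, mul_div_right_comm] at hnon
  have hsum := Finset.sum_le_sum fun σ (_ : σ ∈ Finset.univ) =>
    value_adjCost_add_value_nonadjCost_le s h0 h1 σ m
  rw [Finset.sum_add_distrib] at hsum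
  rw [add_mul, mul_add, mul_div_assoc', mul_div_assoc', mul_comm _ (N : ℝ)]
  linarith

theorem ofReal_mul_sum_succeeds_le {p : unitInterval} (s : Strategy (N + 1)) (h0 : 0 < (p : ℝ))
    (h1 : (p : ℝ) < 1) {a b : ℝ} (ha : 0 ≤ a) (hb : 0 ≤ b)
    (hab : ∀ m, a * ∑ σ, value s (answerWeight p s σ) 0 (hit s σ) m [] ≤
      ∑ σ, value s (answerWeight p s σ) 1 0 m [] + b) :
    ENNReal.ofReal a * ∑ σ : Equiv.Perm (Fin (N + 1)), noise p {z | Succeeds s σ z} ≤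
      ∑ σ : Equiv.Perm (Fin (N + 1)), ∫⁻ z, queryCount s σ z ∂noise p + ENNReal.ofReal b := by
  refine le_of_tendsto (ENNReal.Tendsto.const_mul
    (tendsto_finsetSum _ fun σ _ => tendsto_value_hit s h0 h1 σ)
    (Or.inr ENNReal.ofReal_ne_top)) (Eventually.of_forall fun m => ?_)
  have hq := fun σ h b => (answerWeight_pos (s := s) h0 h1 σ h b).le
  have hV : ∀ σ, 0 ≤ value s (answerWeight p s σ) 0 (hit s σ) m [] := fun σ =>
    value_nonneg (hq σ) (fun _ => le_rfl) (hit_nonneg σ) m []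
  have hT : ∀ σ, 0 ≤ value s (answerWeight p s σ) 1 0 m [] := fun σ =>
    value_nonneg (hq σ) (fun _ => zero_le_one) (fun _ => le_rfl) m []
  rw [← ENNReal.ofReal_sum_of_nonneg fun σ _ => hV σ, ← ENNReal.ofReal_mul ha]
  refine (ENNReal.ofReal_le_ofReal (hab m)).trans ?_
  rw [ENNReal.ofReal_add (Finset.sum_nonneg fun σ _ => hT σ) hb,
    ENNReal.ofReal_sum_of_nonneg fun σ _ => hT σ]
  gcongr with σ
  exact value_one_le_lintegral_queryCount s h0 h1 σ m

end LowerBound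

/-! ### Averaging over the seed -/

section Randomized

variable {n : ℕ} {Ω : Type*} [MeasurableSpace Ω]

theorem measurableSet_succeeds {S : Ω → Strategy n} (hS : ∀ h, Measurable fun ω => S ω h)
    (σ : Equiv.Perm (Fin n)) : MeasurableSet {x : Ω × (ℕ → Bool) | Succeeds (S x.1) σ x.2} := by
  have : {x : Ω × (ℕ → Bool) | Succeeds (S x.1) σ x.2} = ⋃ t : ℕ,
      (fun x : Ω × (ℕ → Bool) => S x.1 (answers (S x.1) σ x.2 t)) ⁻¹'
        {mv | ∃ π, mv = .output π ∧ Monotone fun k => σ (π k)} := by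
    ext x
    simp [Succeeds]
  rw [this]
  exact MeasurableSet.iUnion fun t =>
    measurable_move hS (measurable_answers hS σ t) (MeasurableSet.of_discrete)

theorem measurable_queryCount {S : Ω → Strategy n} (hS : ∀ h, Measurable fun ω => S ω h)
    (σ : Equiv.Perm (Fin n)) :
    Measurable fun x : Ω × (ℕ → Bool) => queryCount (S x.1) σ x.2 := by
  classical
  unfold queryCount
  refine Measurable.tsum fun t => ?_
  exact (Measurable.of_discrete (f := fun mv : Move n =>
    if ∃ i j, mv = .compare i j then (1 : ℝ≥0∞) else 0)).comp
    (measurable_move hS (measurable_answers hS σ t))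

/-- The deterministic bound is linear in the success probability and the query count, with constants
independent of the strategy, so it can be integrated over the seed. -/
theorem ofReal_mul_one_sub_uniformErrorProb_le (A : Algorithm n Ω) (p : unitInterval) {a b : ℝ}
    (hab : ∀ s : Strategy n,
      ENNReal.ofReal a * ∑ σ : Equiv.Perm (Fin n), noise p {z | Succeeds s σ z} ≤
        ∑ σ : Equiv.Perm (Fin n), ∫⁻ z, queryCount s σ z ∂noise p +
          ENNReal.ofReal (n.factorial * b)) :
    ENNReal.ofReal a * (1 - A.uniformErrorProb p) ≤
      A.uniformExpectedQueries p + ENNReal.ofReal b := by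
  have := A.isProbabilityMeasure_seedLaw
  have hnoise : IsProbabilityMeasure (noise p) := by unfold noise; infer_instance
  have hS := A.measurable_strategy
  have hf0 : (n.factorial : ℝ≥0∞) ≠ 0 := by exact_mod_cast n.factorial_ne_zero
  have hft : (n.factorial : ℝ≥0∞) ≠ ⊤ := ENNReal.natCast_ne_top _
  have hsucc : ∀ σ : Equiv.Perm (Fin n), (A.seedLaw.prod (noise p))
      {x | Succeeds (A.strategy x.1) σ x.2} =
      ∫⁻ ω, noise p {z | Succeeds (A.strategy ω) σ z} ∂A.seedLaw := fun σ =>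
    Measure.prod_apply (measurableSet_succeeds hS σ)
  have hsm : ∀ σ : Equiv.Perm (Fin n),
      Measurable fun ω => noise p {z | Succeeds (A.strategy ω) σ z} := fun σ =>
    measurable_measure_prodMk_left (measurableSet_succeeds hS σ)
  have hqm : ∀ σ : Equiv.Perm (Fin n),
      Measurable fun ω => ∫⁻ z, queryCount (A.strategy ω) σ z ∂noise p := fun σ =>
    (measurable_queryCount hS σ).lintegral_prod_right'
  have hexp : ∀ σ : Equiv.Perm (Fin n), A.expectedQueries p σ =
      ∫⁻ ω, ∫⁻ z, queryCount (A.strategy ω) σ z ∂noise p ∂A.seedLaw := fun σ =>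
    lintegral_prod _ (measurable_queryCount hS σ).aemeasurable
  have hint : ENNReal.ofReal a * ∑ σ : Equiv.Perm (Fin n), (A.seedLaw.prod (noise p))
      {x | Succeeds (A.strategy x.1) σ x.2} ≤
      ∑ σ : Equiv.Perm (Fin n), A.expectedQueries p σ + ENNReal.ofReal (n.factorial * b) := by
    simp only [hsucc, hexp]
    rw [← lintegral_finsetSum _ fun σ _ => hsm σ, ← lintegral_finsetSum _ fun σ _ => hqm σ,
      ← lintegral_const_mul _ (Finset.measurable_fun_sum _ fun σ _ => hsm σ)]
    refine (lintegral_mono fun ω => hab (A.strategy ω)).trans (le_of_eq ?_)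
    rw [lintegral_add_right _ measurable_const]
    simp
  have htot : (n.factorial : ℝ≥0∞) ≤ ∑ σ : Equiv.Perm (Fin n), (A.seedLaw.prod (noise p))
      {x | Succeeds (A.strategy x.1) σ x.2} + ∑ σ : Equiv.Perm (Fin n), A.errorProb p σ := by
    rw [← Finset.sum_add_distrib]
    have h1 : ∀ σ : Equiv.Perm (Fin n), 1 ≤ (A.seedLaw.prod (noise p))
        {x | Succeeds (A.strategy x.1) σ x.2} + A.errorProb p σ := fun σ => by
      rw [← measure_univ (μ := A.seedLaw.prod (noise p)),
        ← Set.union_compl_self {x : Ω × (ℕ → Bool) | Succeeds (A.strategy x.1) σ x.2}]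
      exact measure_union_le _ _
    refine le_trans (le_of_eq ?_) (Finset.sum_le_sum fun σ _ => h1 σ)
    simp [Fintype.card_perm]
  have hone : 1 - A.uniformErrorProb p ≤ (∑ σ : Equiv.Perm (Fin n), (A.seedLaw.prod (noise p))
      {x | Succeeds (A.strategy x.1) σ x.2}) / n.factorial := by
    rw [tsub_le_iff_right, Algorithm.uniformErrorProb, ← ENNReal.add_div,
      ENNReal.le_div_iff_mul_le (Or.inl hf0) (Or.inl hft), one_mul]
    exact htot
  refine (mul_le_mul_right hone _).trans ?_
  have hb : ENNReal.ofReal b = ENNReal.ofReal (n.factorial * b) / n.factorial := by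
    rw [ENNReal.ofReal_mul n.factorial.cast_nonneg, ENNReal.ofReal_natCast, mul_comm,
      ENNReal.mul_div_cancel_right hf0 hft]
  rw [hb, Algorithm.uniformExpectedQueries, ← ENNReal.add_div, ← mul_div_assoc]
  exact ENNReal.div_le_div_right hint _

end Randomized

/-! ### Asymptotics of the main term and the loss -/

section Asymptotics

theorem tendsto_log_natCast : Tendsto (fun n : ℕ => Real.log n) atTop atTop :=
  Real.tendsto_log_atTop.comp tendsto_natCast_atTop_atTop

theorem mul_log_sub_le_log_factorial (n : ℕ) :
    (n : ℝ) * Real.log n - n ≤ Real.log n.factorial := by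
  rcases Nat.eq_zero_or_pos n with rfl | hn
  · simp
  · have hn' : (0 : ℝ) < n := by exact_mod_cast hn
    have hf : (0 : ℝ) < n.factorial := by exact_mod_cast n.factorial_pos
    have h := Real.pow_div_factorial_le_exp (n : ℝ) hn'.le n
    have h2 := Real.log_le_log (by positivity) h
    rw [Real.log_div (by positivity) hf.ne', Real.log_pow, Real.log_exp] at h2
    linarith

theorem log_factorial_le_mul_log (n : ℕ) : Real.log n.factorial ≤ n * Real.log n := by
  rw [← Real.log_pow]
  exact Real.log_le_log (by exact_mod_cast n.factorial_pos) (by exact_mod_cast n.factorial_le_pow)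

theorem tendsto_log_factorial_div :
    Tendsto (fun n : ℕ => Real.log n.factorial / (n * Real.log n)) atTop (𝓝 1) := by
  have hlow : Tendsto (fun n : ℕ => 1 - (Real.log n)⁻¹) atTop (𝓝 1) := by
    simpa using tendsto_const_nhds.sub tendsto_log_natCast.inv_tendsto_atTop
  refine tendsto_of_tendsto_of_tendsto_of_le_of_le' hlow tendsto_const_nhds ?_ ?_
  · filter_upwards [eventually_gt_atTop 1] with n hn
    have hn' : (1 : ℝ) < n := by exact_mod_cast hn
    have hl := Real.log_pos hn'
    rw [le_div_iff₀ (by positivity)]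
    refine le_trans (le_of_eq ?_) (mul_log_sub_le_log_factorial n)
    field_simp
  · filter_upwards [eventually_gt_atTop 1] with n hn
    have hn' : (1 : ℝ) < n := by exact_mod_cast hn
    have hl := Real.log_pos hn'
    rw [div_le_one (by positivity)]
    exact log_factorial_le_mul_log n

theorem tendsto_log_two_mul_two_add_div :
    Tendsto (fun x : ℝ => Real.log (2 * (2 + x)) / x) atTop (𝓝 0) := by
  have hy : Tendsto (fun x : ℝ => 2 * (2 + x)) atTop atTop :=
    (tendsto_atTop_add_const_left _ _ tendsto_id).const_mul_atTop two_pos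
  have h1 : Tendsto (fun x : ℝ => Real.log (2 * (2 + x)) / (2 * (2 + x))) atTop (𝓝 0) :=
    (Real.isLittleO_log_id_atTop.tendsto_div_nhds_zero).comp hy
  have h2 : Tendsto (fun x : ℝ => 4 * x⁻¹ + 2) atTop (𝓝 (4 * 0 + 2)) :=
    (tendsto_inv_atTop_zero.const_mul 4).add_const 2
  have h3 := h1.mul h2
  rw [zero_mul] at h3
  refine h3.congr' ?_
  filter_upwards [eventually_gt_atTop 0] with x hx
  field_simp
  ring

/-- The probability with which the genie's reference measure predicts an adjacency. -/
noncomputable def genieRate (n : ℕ) : ℝ := 1 / (2 + Real.log n)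

theorem genieRate_pos (n : ℕ) : 0 < genieRate n := by
  have := Real.log_natCast_nonneg n
  unfold genieRate
  positivity

theorem genieRate_lt_one (n : ℕ) : genieRate n < 1 := by
  have := Real.log_natCast_nonneg n
  rw [genieRate, div_lt_one (by linarith)]
  linarith

theorem tendsto_genieRate : Tendsto genieRate atTop (𝓝 0) := by
  have h := (tendsto_atTop_add_const_left _ (2 : ℝ) tendsto_log_natCast).inv_tendsto_atTop
  exact h.congr fun n => (one_div _).symm

/-- An upper bound for the information content of a query, in nats. -/
noncomputable def queryInfo (I : ℝ) (n : ℕ) : ℝ := I - Real.log (1 - genieRate n)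

theorem tendsto_queryInfo (I : ℝ) : Tendsto (queryInfo I) atTop (𝓝 I) := by
  have h : Tendsto (fun n => 1 - genieRate n) atTop (𝓝 1) := by
    simpa using tendsto_const_nhds.sub tendsto_genieRate
  have h2 := (Real.continuousAt_log one_ne_zero).tendsto.comp h
  have h3 := h2.const_sub I
  rw [Real.log_one, sub_zero] at h3
  exact h3

theorem queryInfo_pos {I : ℝ} (hI : 0 < I) (n : ℕ) : 0 < queryInfo I n := by
  have := Real.log_nonpos (x := 1 - genieRate n) (by linarith [genieRate_lt_one n])
    (by linarith [genieRate_pos n])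
  unfold queryInfo
  linarith

/-- The coefficient of the success probability in the lower bound. -/
noncomputable def mainTerm (D I : ℝ) (n : ℕ) : ℝ :=
  (n - 1) * Real.log n / D + Real.log n.factorial / queryInfo I n

/-- The loss in the lower bound. -/
noncomputable def lossTerm (D I : ℝ) (n : ℕ) : ℝ :=
  (n - 1) / D + (1 + 2 * n * Real.log (2 / genieRate n)) / queryInfo I n

theorem tendsto_mainTerm_div {D I : ℝ} (hI : 0 < I) :
    Tendsto (fun n => mainTerm D I n / (n * Real.log n)) atTop (𝓝 (1 / D + 1 / I)) := by
  have h1 : Tendsto (fun n : ℕ => (1 - (n : ℝ)⁻¹) / D) atTop (𝓝 (1 / D)) := by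
    simpa using (tendsto_inv_atTop_nhds_zero_nat.const_sub (1 : ℝ)).div_const D
  have h2 := h1.add (tendsto_log_factorial_div.div (tendsto_queryInfo I) hI.ne')
  refine h2.congr' ?_
  filter_upwards [eventually_gt_atTop 1] with n hn
  have hn' : (1 : ℝ) < n := by exact_mod_cast hn
  have hl := Real.log_pos hn'
  have hn0 : (n : ℝ) ≠ 0 := by positivity
  rw [mainTerm, add_div]
  congr 1
  · field_simp
  · simp only [Pi.div_apply]
    exact div_right_comm _ _ _

/-- The rate `1 / (2 + log n)` tends to 0, yet slowly enough that `n log (2 / ρ)` is of order `n log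
log n`. -/
theorem tendsto_lossTerm_div {D I : ℝ} (hI : 0 < I) :
    Tendsto (fun n => lossTerm D I n / (n * Real.log n)) atTop (𝓝 0) := by
  have hlog := tendsto_log_natCast.inv_tendsto_atTop
  have hinv := tendsto_inv_atTop_nhds_zero_nat (𝕜 := ℝ)
  have h1 : Tendsto (fun n : ℕ => (1 - (n : ℝ)⁻¹) * (Real.log n)⁻¹ / D) atTop (𝓝 0) := by
    simpa using ((tendsto_const_nhds.sub hinv).mul hlog).div_const D
  have h2 : Tendsto (fun n : ℕ => ((n : ℝ)⁻¹ * (Real.log n)⁻¹ +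
      2 * (Real.log (2 * (2 + Real.log n)) / Real.log n)) / queryInfo I n) atTop (𝓝 0) := by
    have h := ((hinv.mul hlog).add ((tendsto_log_two_mul_two_add_div.comp
      tendsto_log_natCast).const_mul 2)).div (tendsto_queryInfo I) hI.ne'
    rw [mul_zero, mul_zero, add_zero, zero_div] at h
    exact h
  have h3 := h1.add h2
  rw [add_zero] at h3
  refine h3.congr' ?_
  filter_upwards [eventually_gt_atTop 1] with n hn
  have hn' : (1 : ℝ) < n := by exact_mod_cast hn
  have hl := Real.log_pos hn'
  have hn0 : (n : ℝ) ≠ 0 := by positivity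
  have hJ := (queryInfo_pos hI n).ne'
  have hrate : 2 / genieRate n = 2 * (2 + Real.log n) := by
    rw [genieRate, div_div_eq_mul_div, div_one]
  rw [lossTerm, hrate, add_div]
  field_simp

end Asymptotics

theorem capacity_eq {p : ℝ} :
    capacity p = (Real.log 2 - Real.binEntropy p) / Real.log 2 := by
  have : Real.log 2 ≠ 0 := (Real.log_pos one_lt_two).ne'
  rw [capacity, binaryEntropy, Real.logb, Real.logb, Real.binEntropy, Real.log_inv, Real.log_inv]
  field_simp
  ring

end NoisySorting

theorem theorem2 (p : unitInterval) (hp0 : 0 < (p : ℝ)) (hp1 : (p : ℝ) < 1 / 2)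
    (δ : ℕ → ℝ≥0∞) (hδ : Tendsto δ atTop (𝓝 0)) :
    ∃ ε : ℕ → ℝ, Tendsto ε atTop (𝓝 0) ∧
      ∀ (n : ℕ) (Ω : Type*) [MeasurableSpace Ω] (A : NoisySorting.Algorithm n Ω),
        A.uniformErrorProb p ≤ δ n →
          ENNReal.ofReal ((1 - ε n) *
              (1 / NoisySorting.capacity p +
                1 / ((1 - 2 * (p : ℝ)) * Real.logb 2 ((1 - (p : ℝ)) / (p : ℝ)))) *
              ((n : ℝ) * Real.logb 2 n)) ≤
            A.uniformExpectedQueries p := by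
  open NoisySorting in
  set D := (1 - 2 * (p : ℝ)) * Real.log ((1 - p) / p) with hD
  set I := Real.log 2 - Real.binEntropy p with hI
  have hlp : 0 < Real.log ((1 - p) / p) :=
    Real.log_pos (by rw [lt_div_iff₀ hp0]; linarith)
  have hD0 : 0 < D := mul_pos (by linarith) hlp
  have hI0 : 0 < I := sub_pos.2 (Real.binEntropy_lt_log_two.2 (by
    rw [← one_div]; exact hp1.ne))
  have hl2 : 0 < Real.log 2 := Real.log_pos one_lt_two
  set K := 1 / D + 1 / I with hK
  have hK0 : 0 < K := by positivity
  have hconst : ∀ n : ℕ, (1 / capacity p +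
      1 / ((1 - 2 * (p : ℝ)) * Real.logb 2 ((1 - (p : ℝ)) / (p : ℝ)))) *
        ((n : ℝ) * Real.logb 2 n) = K * (n * Real.log n) := by
    intro n
    have : (1 - 2 * (p : ℝ)) * Real.logb 2 ((1 - (p : ℝ)) / (p : ℝ)) = D / Real.log 2 := by
      rw [Real.logb, hD, mul_div_assoc]
    rw [this, capacity_eq, ← hI, hK, Real.logb]
    field_simp
    ring
  -- Capping at 1 keeps `toReal` meaningful where `δ n` is infinite.
  set η : ℕ → ℝ := fun n => (min (δ n) 1).toReal with hη
  have hη0 : Tendsto η atTop (𝓝 0) := by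
    have h : Tendsto (fun n => min (δ n) 1) atTop (𝓝 0) := by
      simpa using hδ.min (tendsto_const_nhds (x := (1 : ℝ≥0∞)))
    exact (ENNReal.tendsto_toReal ENNReal.zero_ne_top).comp h
  -- `ε` is solved from the requirement that the claimed bound equal `mainTerm * (1 - η) -
  -- lossTerm`.
  refine ⟨fun n => 1 - (mainTerm D I n * (1 - η n) - lossTerm D I n) / (K * (n * Real.log n)),
    ?_, ?_⟩
  · have h1 := ((tendsto_mainTerm_div (D := D) hI0).mul (hη0.const_sub 1)).sub
      (tendsto_lossTerm_div (D := D) hI0)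
    have h2 := (h1.div_const K).const_sub 1
    rw [← hK, sub_zero, sub_zero, mul_one, div_self hK0.ne', sub_self] at h2
    refine h2.congr fun n => ?_
    simp only [div_eq_mul_inv, mul_inv]
    ring
  · intro n Ω _ A hA
    rw [mul_assoc, hconst, sub_sub_cancel]
    rcases Nat.lt_or_ge 1 n with hn | hn
    swap
    -- For `n ≤ 1` the claimed bound is 0, whatever the division by zero makes of `ε n`.
    · have : Real.log n = 0 := by interval_cases n <;> simp
      simp [this]
    obtain ⟨N, rfl⟩ : ∃ N, n = N + 1 := ⟨n - 1, by omega⟩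
    have hn' : (1 : ℝ) < (N + 1 : ℕ) := by exact_mod_cast hn
    have hl := Real.log_pos hn'
    rw [div_mul_cancel₀ _ (by positivity)]
    have hJ0 := queryInfo_pos hI0 (N + 1)
    have hmain : 0 ≤ mainTerm D I (N + 1) := by
      have h1 := Real.log_natCast_nonneg (N + 1).factorial
      have h2 : (0 : ℝ) ≤ (N + 1 : ℕ) - 1 := by linarith
      unfold mainTerm
      positivity
    have hloss : 0 ≤ lossTerm D I (N + 1) := by
      have h1 : 0 ≤ Real.log (2 / genieRate (N + 1)) := Real.log_nonneg (by
        rw [le_div_iff₀ (genieRate_pos _)]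
        linarith [genieRate_lt_one (N + 1)])
      have h2 : (0 : ℝ) ≤ (N + 1 : ℕ) - 1 := by linarith
      unfold lossTerm
      positivity
    have key := ofReal_mul_one_sub_uniformErrorProb_le A p (a := mainTerm D I (N + 1))
      (b := lossTerm D I (N + 1)) fun s =>
        ofReal_mul_sum_succeeds_le s hp0 (by linarith) hmain (by positivity) fun m => by
          have h := mul_sum_value_hit_le s hp0 hp1 (genieRate_pos (N + 1))
            (genieRate_lt_one (N + 1)) hD rfl hD0 hJ0 m
          simpa [mainTerm, lossTerm, queryInfo] using h
    have hmin : ENNReal.ofReal (1 - η (N + 1)) ≤ 1 - A.uniformErrorProb p := by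
      rw [ENNReal.ofReal_sub _ ENNReal.toReal_nonneg, ENNReal.ofReal_one,
        ENNReal.ofReal_toReal (min_lt_of_right_lt ENNReal.one_lt_top).ne]
      rcases le_total (δ (N + 1)) 1 with h | h
      · rw [min_eq_left h]
        exact tsub_le_tsub_left hA _
      · rw [min_eq_right h, tsub_self]
        exact zero_le
    rw [ENNReal.ofReal_sub _ hloss, ENNReal.ofReal_mul hmain, tsub_le_iff_right]
    exact (mul_le_mul_right hmin _).trans key
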